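/- Let $G$ be a (finite or infinite) graph in which every vertex has degree at most $\Delta$, let $Q=\{1,\dots,q\}$ be the set of spins, and let $\lambda\in[0,1]$. For a finite set $R$ of vertices let $\partial R$ be the set of vertices outside $R$ that are adjacent to $R$, and let $E(R)$ be the set of edges with at least one endpoint in $R$. A boundary configuration is a function $\mathcal B:\partial R\to\{0\}\cup Q$, where the spin $0$ is a free boundary that does not interact. The Gibbs measure $\pi_{\mathcal B}$ of the anti-ferromagnetic Potts model is the probability distribution on $Q^R$ with $$\pi_{\mathcal B}(\sigma)=\lambda^{\mathrm{mon}(\sigma)}/Z,\qquad Z=\sum_{\sigma\in Q^R}\lambda^{\mathrm{mon}(\sigma)},$$ where $\mathrm{mon}(\sigma)$ is the number of edges of $E(R)$ whose two endpoints have the same spin of $Q$ under $\sigma$ and $\mathcal B$ (and $0^0=1$). For $\Lambda\subseteq R$ let $\pi_{\mathcal B,\Lambda}$ be the distribution that $\pi_{\mathcal B}$ induces on $Q^\Lambda$. The model on $G$ has strong spatial mixing if there are constants $\eta,\eta'>0$ such that for every non-empty finite $R$, every $\Lambda\subseteq R$, every $y\in\partial R$ and every two boundary configurations $\mathcal B,\mathcal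 B'$ on $\partial R$ that differ only at $y$ and satisfy $\mathcal B_y,\mathcal B'_y\in Q$, the measures $\pi_{\mathcal B}$ and $\pi_{\mathcal B'}$ are well defined (that is, the normalising constants $Z$ are positive) and $$d_{\mathrm{TV}}(\pi_{\mathcal B,\Lambda},\pi_{\mathcal B',\Lambda})\le \eta\,|\Lambda|\,\exp(-\eta' d(y,\Lambda)),$$ where $d(y,\Lambda)$ is the length of a shortest path of $G$ from $y$ to $\Lambda$ whose vertices other than $y$ all lie in $R$ (with $\exp(-\infty)=0$ if there is none). Theorem. If $q>(1-\lambda)(2\Delta-1)$, then the anti-ferromagnetic Potts model on $G$ with parameters $q$ and $\lambda$ has strong spatial mixing. -/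

import Mathlib

/-! The anti-ferromagnetic Potts model with `q` spins `Fin q` and parameter `lam = exp (-β)` on a
locally finite graph, with boundary conditions on the vertex boundary of a finite region. -/

namespace Potts

noncomputable section

universe u

variable {V : Type u}

/-- The vertex boundary `∂R`: the vertices outside `R` that are adjacent to a vertex of `R`. -/
def boundary (G : SimpleGraph V) (R : Finset V) : Set V :=
  {v | v ∉ R ∧ ∃ u ∈ R, G.Adj u v}

/-- Configurations on the region `R`. -/
abbrev Config (q : ℕ) (R : Finset V) : Type u := R → Fin q

/-- Boundary configurations on `∂R`; the value `none` is the free spin `0`. -/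
abbrev BoundaryConfig (G : SimpleGraph V) (q : ℕ) (R : Finset V) : Type u :=
  boundary G R → Option (Fin q)

open Classical in
/-- `E(R)`: the edges with at least one endpoint in `R`. -/
def edgesMeeting (G : SimpleGraph V) [G.LocallyFinite] (R : Finset V) : Finset (Sym2 V) :=
  R.biUnion fun v => G.incidenceFinset v

open Classical in
/-- The spins given by `σ` on `R` and by `B` on `∂R` (and no spin elsewhere). -/
def spin (G : SimpleGraph V) {q : ℕ} {R : Finset V} (B : BoundaryConfig G q R)
    (σ : Config q R) (v : V) : Option (Fin q) :=
  if h : v ∈ R then some (σ ⟨v, h⟩)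
  else if h' : v ∈ boundary G R then B ⟨v, h'⟩
  else none

open Classical in
/-- The number of monochromatic edges of `E(R)`. A free boundary vertex is never the endpoint of a
monochromatic edge. -/
def mon (G : SimpleGraph V) [G.LocallyFinite] {q : ℕ} {R : Finset V} (B : BoundaryConfig G q R)
    (σ : Config q R) : ℕ :=
  ((edgesMeeting G R).filter fun e => ∃ c : Fin q, ∀ v ∈ e, spin G B σ v = some c).card

open Classical in
/-- The partition function `Z = ∑_σ lam ^ mon(σ)`. -/
def partitionFunction (G : SimpleGraph V) [G.LocallyFinite] {q : ℕ} (lam : ℝ) {R : Finset V}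
    (B : BoundaryConfig G q R) : ℝ :=
  ∑ σ : Config q R, lam ^ mon G B σ

/-- The finite-volume Gibbs measure `π_B(σ) = lam ^ mon(σ) / Z`. For `lam = 0` this is the uniform
distribution on the configurations without monochromatic edges (recall `0 ^ 0 = 1`). -/
def gibbs (G : SimpleGraph V) [G.LocallyFinite] {q : ℕ} (lam : ℝ) {R : Finset V}
    (B : BoundaryConfig G q R) (σ : Config q R) : ℝ :=
  lam ^ mon G B σ / partitionFunction G lam B

open Classical in
/-- The distribution `π_{B,Λ}` that `π_B` induces on the configurations of `Λ ⊆ R`. -/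
def marginal (G : SimpleGraph V) [G.LocallyFinite] {q : ℕ} (lam : ℝ) {R : Finset V}
    (B : BoundaryConfig G q R) {Λ : Finset V} (hΛ : Λ ⊆ R) (τ : Config q Λ) : ℝ :=
  ∑ σ : Config q R with Finset.restrict₂ (π := fun _ => Fin q) hΛ σ = τ, gibbs G lam B σ

/-- The total variation distance of two distributions on a finite set. -/
def tvDist {α : Type*} [Fintype α] (p p' : α → ℝ) : ℝ :=
  (1 / 2) * ∑ a, |p a - p' a|

/-- The distance within `R` from `y` to `Λ`: the length of a shortest path from `y` to a vertex
of `Λ` all of whose vertices other than `y` lie in `R` (`⊤` if there is none). -/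
def distWithin (G : SimpleGraph V) (R : Finset V) (y : V) (Λ : Finset V) : ℕ∞ :=
  ⨅ v ∈ Λ, (G.induce (insert y (R : Set V))).spanningCoe.edist y v

/-- `exp (-η' d)`, with value `0` at `d = ∞`. -/
def expDecay (η' : ℝ) (d : ℕ∞) : ℝ :=
  if d = ⊤ then 0 else Real.exp (-η' * (d.toNat : ℝ))

open Classical in
/-- Strong spatial mixing of the Potts model on `G` with parameters `q` and `lam`. Positivity of
the partition functions, which says that the Gibbs measures exist, is automatic for `lam > 0`. -/
def StrongSpatialMixing (G : SimpleGraph V) [G.LocallyFinite] (q : ℕ) (lam : ℝ) : Prop :=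
  ∃ η η' : ℝ, 0 < η ∧ 0 < η' ∧
    ∀ R : Finset V, R.Nonempty → ∀ (Λ : Finset V) (hΛ : Λ ⊆ R) (y : boundary G R)
      (B B' : BoundaryConfig G q R),
      (∀ v, v ≠ y → B v = B' v) → B y ≠ B' y → B y ≠ none → B' y ≠ none →
        0 < partitionFunction G lam B ∧ 0 < partitionFunction G lam B' ∧
        tvDist (marginal G lam B hΛ) (marginal G lam B' hΛ)
          ≤ η * (Λ.card : ℝ) * expDecay η' (distWithin G R y Λ)

end

end Potts

/-! Once the boundary spins are absorbed into an external field, each spin at `y` acts on every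
neighbour `f` of `y` in the region by multiplying the field at `f` by `lam` at that one spin.
Changing `y` thus splits into changes seen by one vertex `f` at a time.

Condition on the spin `s` of `f`. Before the extra neighbour acts, at most `Δ - 1` other neighbours
or field factors touch `f`, each removing weight at most `1 - lam`, so every spin of `f` has
probability at most `1 / (q - (1 - lam) (Δ - 1))`. Moving the weakening from `c` to `c'` therefore
moves mass at most `(1 - lam) / (q - (1 - lam) Δ)` in the law of `f` (`abs_weakened_mean_sub_le`,
`Admissible.mul_slice_le`).

Given its spin, `f` is itself a boundary vertex for its at most `Δ - 1` remaining neighbours, so the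
argument recurs on a graph with the edges at `f` deleted. Each step away from `y` gains the factor
`(1 - lam) (Δ - 1) / (q - (1 - lam) Δ)`, which is below `1` exactly when `q > (1 - lam) (2 Δ - 1)`
(`Admissible.abs_mean_pin_sub_le_pow`). -/

namespace Potts

open Finset

set_option linter.unusedSectionVars false

/-! ### Potts models with external field, and conditioning on one spin -/

section FieldModel

variable {W Q : Type*} [DecidableEq W] [DecidableEq Q]

/-- The interaction of an edge under the configuration `σ`. -/
def edgeWeight (lam : ℝ) (σ : W → Q) (e : Sym2 W) : ℝ :=
  if (e.map σ).IsDiag then lam else 1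

/-- The external field `h`, weakened by a factor `lam` at the spin `s` of the vertices of `T`, as if
each of them had an additional neighbour of spin `s`. -/
def pin (lam : ℝ) (h : W → Q → ℝ) (T : Finset W) (s : Q) (v : W) (i : Q) : ℝ :=
  h v i * if v ∈ T ∧ i = s then lam else 1

/-- The edges that avoid the vertex `f`. -/
def away (E : Finset (Sym2 W)) (f : W) : Finset (Sym2 W) := E.filter fun e => f ∉ e

variable [Fintype W] [Fintype Q]

/-- The neighbours of `f` along the edges in `E`. -/
def nbrs (E : Finset (Sym2 W)) (f : W) : Finset W := univ.filter fun w => s(f, w) ∈ E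

/-- The weight of `σ` in the Potts model with edge set `E` and external field `h`. -/
def weight (lam : ℝ) (E : Finset (Sym2 W)) (h : W → Q → ℝ) (σ : W → Q) : ℝ :=
  (∏ v, h v (σ v)) * ∏ e ∈ E, edgeWeight lam σ e

/-- The part of `weight` that does not involve the vertex `f`. -/
def restWeight (lam : ℝ) (E : Finset (Sym2 W)) (h : W → Q → ℝ) (f : W) (σ : W → Q) : ℝ :=
  (∏ v ∈ univ.erase f, h v (σ v)) * ∏ e ∈ away E f, edgeWeight lam σ e

/-- The unnormalised expectation of `φ`. -/
def weightedSum (lam : ℝ) (E : Finset (Sym2 W)) (h : W → Q → ℝ) (φ : (W → Q) → ℝ) : ℝ :=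
  ∑ σ, weight lam E h σ * φ σ

/-- The unnormalised expectation of `φ` given that `f` has spin `s`, without the field at `f`. -/
noncomputable def slice (lam : ℝ) (E : Finset (Sym2 W)) (h : W → Q → ℝ) (f : W) (s : Q)
    (φ : (W → Q) → ℝ) : ℝ :=
  (∑ σ, restWeight lam E (pin lam h (nbrs E f) s) f σ * φ σ) / Fintype.card Q

theorem edgeWeight_mk (lam : ℝ) (σ : W → Q) (v w : W) :
    edgeWeight lam σ s(v, w) = if σ v = σ w then lam else 1 := by
  simp [edgeWeight]

theorem edgeWeight_nonneg {lam : ℝ} (h0 : 0 ≤ lam) (σ : W → Q) (e : Sym2 W) :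
    0 ≤ edgeWeight lam σ e := by
  unfold edgeWeight; split_ifs <;> linarith

theorem mem_nbrs {E : Finset (Sym2 W)} {f w : W} : w ∈ nbrs E f ↔ s(f, w) ∈ E := by
  simp [nbrs]

theorem notMem_nbrs_self {E : Finset (Sym2 W)} (hE : ∀ e ∈ E, ¬ e.IsDiag) (f : W) :
    f ∉ nbrs E f := fun hf => hE _ (mem_nbrs.1 hf) (by simp)

theorem prod_edgeWeight_eq (lam : ℝ) (E : Finset (Sym2 W)) (f : W) (σ : W → Q) :
    ∏ e ∈ E, edgeWeight lam σ e =
      (∏ w ∈ nbrs E f, if σ w = σ f then lam else 1) * ∏ e ∈ away E f, edgeWeight lam σ e := by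
  rw [← prod_filter_mul_prod_filter_not E (fun e => f ∈ e)]
  congr 1
  have : E.filter (fun e => f ∈ e) = (nbrs E f).image (fun w => s(f, w)) := by
    ext e
    simp only [mem_filter, mem_image, mem_nbrs]
    constructor
    · rintro ⟨he, hf⟩
      obtain ⟨w, rfl⟩ := Sym2.mem_iff_exists.1 hf
      exact ⟨w, he, rfl⟩
    · rintro ⟨w, hw, rfl⟩
      exact ⟨hw, by simp⟩
  rw [this, prod_image (fun a _ b _ hab => Sym2.congr_right.1 hab)]
  refine prod_congr rfl fun w _ => ?_
  rw [edgeWeight_mk]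
  simp only [eq_comm]

theorem prod_pin (lam : ℝ) (h : W → Q → ℝ) {A T : Finset W} (hT : T ⊆ A) (s : Q) (σ : W → Q) :
    ∏ v ∈ A, pin lam h T s v (σ v) =
      (∏ v ∈ A, h v (σ v)) * ∏ w ∈ T, if σ w = s then lam else 1 := by
  simp only [pin, prod_mul_distrib]
  congr 1
  rw [← prod_subset hT (fun v _ hv => by simp [hv])]
  exact prod_congr rfl fun v hv => by simp [hv]

theorem restWeight_pin_nbrs (lam : ℝ) {E : Finset (Sym2 W)} (hE : ∀ e ∈ E, ¬ e.IsDiag)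
    (h : W → Q → ℝ) (f : W) (s : Q) (σ : W → Q) :
    restWeight lam E (pin lam h (nbrs E f) s) f σ =
      (∏ w ∈ nbrs E f, if σ w = s then lam else 1) * restWeight lam E h f σ := by
  unfold restWeight
  rw [prod_pin]
  · ring
  · intro w hw
    simp only [mem_erase, mem_univ, and_true]
    rintro rfl
    exact notMem_nbrs_self hE _ hw

theorem weight_eq (lam : ℝ) {E : Finset (Sym2 W)} (hE : ∀ e ∈ E, ¬ e.IsDiag)
    (h : W → Q → ℝ) (f : W) (σ : W → Q) :
    weight lam E h σ = h f (σ f) * restWeight lam E (pin lam h (nbrs E f) (σ f)) f σ := by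
  rw [restWeight_pin_nbrs lam hE, weight, prod_edgeWeight_eq lam E f, restWeight,
    ← mul_prod_erase univ _ (mem_univ f)]
  ring

theorem weight_away_eq (lam : ℝ) {E : Finset (Sym2 W)} (hE : ∀ e ∈ E, ¬ e.IsDiag)
    (h : W → Q → ℝ) (f : W) (s : Q) (σ : W → Q) :
    weight lam (away E f) (pin lam h (nbrs E f) s) σ =
      h f (σ f) * restWeight lam E (pin lam h (nbrs E f) s) f σ := by
  rw [weight, restWeight, ← mul_prod_erase univ _ (mem_univ f)]
  have : pin lam h (nbrs E f) s f (σ f) = h f (σ f) := by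
    simp [pin, notMem_nbrs_self hE f]
  rw [this, mul_assoc]

theorem restWeight_update (lam : ℝ) (E : Finset (Sym2 W)) (h : W → Q → ℝ) (f : W) (σ : W → Q)
    (t : Q) : restWeight lam E h f (Function.update σ f t) = restWeight lam E h f σ := by
  unfold restWeight
  congr 1
  · refine prod_congr rfl fun v hv => ?_
    rw [Function.update_of_ne (mem_erase.1 hv).1]
  · refine prod_congr rfl fun e he => ?_
    unfold edgeWeight
    have : e.map (Function.update σ f t) = e.map σ := by
      refine Sym2.map_congr fun v hv => Function.update_of_ne ?_ _ _
      rintro rfl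
      exact (mem_filter.1 he).2 hv
    rw [this]

/-- Since `F` ignores the spin at `f`, the sum factorises; dividing by `Fintype.card Q` corrects for
`∑ σ, F σ` counting each configuration off `f` once per spin. -/
theorem sum_mul_of_update_eq (f : W) (a : Q → ℝ) (F : (W → Q) → ℝ)
    (hF : ∀ σ t, F (Function.update σ f t) = F σ) :
    ∑ σ, a (σ f) * F σ = (∑ t, a t) * ((∑ σ, F σ) / Fintype.card Q) := by
  cases isEmpty_or_nonempty Q with
  | inl hQ =>
    have : IsEmpty (W → Q) := ⟨fun σ => hQ.elim (σ f)⟩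
    simp
  | inr hQ =>
    obtain ⟨t₀⟩ := hQ
    have key : ∀ b : Q → ℝ, ∑ σ, b (σ f) * F σ =
        (∑ t, b t) * ∑ τ : {j // j ≠ f} → Q, F ((Equiv.funSplitAt f Q).symm (t₀, τ)) := by
      intro b
      rw [← (Equiv.funSplitAt f Q).symm.sum_comp, Fintype.sum_prod_type, sum_mul]
      refine sum_congr rfl fun t _ => ?_
      rw [mul_sum]
      refine sum_congr rfl fun τ _ => ?_
      congr 1
      · simp [Equiv.funSplitAt]
      · rw [← hF ((Equiv.funSplitAt f Q).symm (t₀, τ)) t]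
        congr 1
        ext v
        by_cases hv : v = f
        · subst hv; simp [Equiv.funSplitAt]
        · simp [Equiv.funSplitAt, hv]
    have h1 := key fun _ => 1
    have hq : (Fintype.card Q : ℝ) ≠ 0 := by
      have : Nonempty Q := ⟨t₀⟩
      exact_mod_cast Fintype.card_ne_zero
    simp only [one_mul, sum_const, card_univ, nsmul_eq_mul, mul_one] at h1
    rw [key a, h1, mul_div_cancel_left₀ _ hq]

theorem weightedSum_eq_sum_slice (lam : ℝ) {E : Finset (Sym2 W)} (hE : ∀ e ∈ E, ¬ e.IsDiag)
    (h : W → Q → ℝ) (f : W) (φ : (W → Q) → ℝ) (hφ : ∀ σ t, φ (Function.update σ f t) = φ σ) :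
    weightedSum lam E h φ = ∑ s, h f s * slice lam E h f s φ := by
  have : ∀ s, h f s * slice lam E h f s φ = ∑ σ, (if σ f = s then h f s else 0) *
      (restWeight lam E (pin lam h (nbrs E f) s) f σ * φ σ) := by
    intro s
    rw [sum_mul_of_update_eq f (fun t => if t = s then h f s else 0)]
    · simp [slice]
    · intro σ t
      rw [restWeight_update, hφ]
  simp only [this]
  rw [sum_comm, weightedSum]
  refine sum_congr rfl fun σ _ => ?_
  rw [weight_eq lam hE h f]
  simp [mul_assoc]

/-- Without its edges `f` is isolated and its field factors out. Conditioning thus yields a model on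
the same vertex set with fewer edges, and it makes sense even for spins with `h f s = 0`. -/
theorem weightedSum_away_eq (lam : ℝ) {E : Finset (Sym2 W)} (hE : ∀ e ∈ E, ¬ e.IsDiag)
    (h : W → Q → ℝ) (f : W) (s : Q) (φ : (W → Q) → ℝ)
    (hφ : ∀ σ t, φ (Function.update σ f t) = φ σ) :
    weightedSum lam (away E f) (pin lam h (nbrs E f) s) φ =
      (∑ t, h f t) * slice lam E h f s φ := by
  rw [slice, ← sum_mul_of_update_eq f (h f), weightedSum]
  · refine sum_congr rfl fun σ _ => ?_
    rw [weight_away_eq lam hE, mul_assoc]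
  · intro σ t
    rw [restWeight_update, hφ]

theorem slice_pin_self (lam : ℝ) (E : Finset (Sym2 W)) (h : W → Q → ℝ) (f : W) (c s : Q)
    (φ : (W → Q) → ℝ) : slice lam E (pin lam h {f} c) f s φ = slice lam E h f s φ := by
  unfold slice restWeight
  congr 1
  refine sum_congr rfl fun σ _ => ?_
  congr 2
  refine prod_congr rfl fun v hv => ?_
  simp [pin, (mem_erase.1 hv).1]

/-! ### The degree budget and positivity of partition functions -/

/-- The fields `h` come from at most `Δ - deg v` neighbours of each vertex `v`, less one for the
vertices of `T`. -/
structure Admissible (lam : ℝ) (Δ : ℕ) (E : Finset (Sym2 W)) (h : W → Q → ℝ) (T : Finset W) :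
    Prop where
  not_isDiag : ∀ e ∈ E, ¬ e.IsDiag
  nonneg : ∀ v i, 0 ≤ h v i
  le_one : ∀ v i, h v i ≤ 1
  sum_le : ∀ v, ∑ i, (1 - h v i) + (1 - lam) * ((nbrs E v).card + if v ∈ T then 1 else 0) ≤
    (1 - lam) * Δ

namespace Admissible

variable {lam : ℝ} {Δ : ℕ} {E : Finset (Sym2 W)} {h : W → Q → ℝ} {S T : Finset W}

/-- Pinning costs a vertex at most `1 - lam`, which is the unit reserved for it. Disjointness is
needed because a vertex has only one unit in reserve. -/
theorem pin (H : Admissible lam Δ E h (S ∪ T)) (h0 : 0 ≤ lam) (h1 : lam ≤ 1)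
    (hd : Disjoint S T) (s : Q) : Admissible lam Δ E (pin lam h S s) T := by
  refine ⟨H.1, fun v i => ?_, fun v i => ?_, fun v => le_trans ?_ (H.4 v)⟩
  · refine mul_nonneg (H.2 v i) ?_
    split_ifs <;> linarith
  · refine mul_le_one₀ (H.3 v i) ?_ ?_ <;> split_ifs <;> linarith
  · by_cases hS : v ∈ S
    · have hT : v ∉ T := disjoint_left.1 hd hS
      have : ∑ i, (1 - Potts.pin lam h S s v i) ≤
          ∑ i, ((1 - h v i) + if i = s then 1 - lam else 0) := by
        refine sum_le_sum fun i _ => ?_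
        by_cases hi : i = s
        · have := mul_le_mul_of_nonneg_left (H.3 v i) (sub_nonneg.2 h1)
          simp only [Potts.pin, hS, hi, and_self, if_true] at *
          linarith
        · simp [Potts.pin, hi]
      rw [sum_add_distrib, sum_ite_eq' univ s, if_pos (mem_univ s)] at this
      simp only [hT, hS, mem_union, or_false, if_true, if_false]
      linarith
    · simp [Potts.pin, hS]

/-- Each neighbour of `f` loses an edge, which frees one unit for the spin of `f` to act as a field.
-/
theorem away (H : Admissible lam Δ E h T) (h1 : lam ≤ 1) (f : W) :
    Admissible lam Δ (away E f) h (nbrs E f) := by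
  refine ⟨fun e he => H.1 e (mem_filter.1 he).1, H.2, H.3, fun v => le_trans ?_ (H.4 v)⟩
  have key : ((nbrs (Potts.away E f) v).card : ℝ) + (if v ∈ nbrs E f then 1 else 0) ≤
      (nbrs E v).card := by
    have hsub : nbrs (Potts.away E f) v ⊆ nbrs E v := fun w hw =>
      mem_nbrs.2 (mem_filter.1 (mem_nbrs.1 hw)).1
    split_ifs with hv
    · have : nbrs (Potts.away E f) v ⊂ nbrs E v := by
        refine (ssubset_iff_of_subset hsub).2 ⟨f, ?_, fun hf => ?_⟩
        · rw [mem_nbrs, Sym2.eq_swap]; exact mem_nbrs.1 hv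
        · exact (mem_filter.1 (mem_nbrs.1 hf)).2 (by simp)
      exact_mod_cast card_lt_card this
    · simpa using card_le_card hsub
  refine add_le_add le_rfl (mul_le_mul_of_nonneg_left (key.trans ?_) (sub_nonneg.2 h1))
  split_ifs <;> simp

theorem sum_pos (H : Admissible lam Δ E h T) (h1 : lam ≤ 1)
    (hq : (1 - lam) * Δ < Fintype.card Q) (v : W) : 0 < ∑ i, h v i := by
  have h4 := H.4 v
  rw [sum_sub_distrib] at h4
  simp only [sum_const, card_univ, nsmul_eq_mul, mul_one] at h4
  have : 0 ≤ (1 - lam) * ((nbrs E v).card + if v ∈ T then (1 : ℝ) else 0) :=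
    mul_nonneg (by linarith) (by positivity)
  linarith

theorem pin_away (H : Admissible lam Δ E h T) (h0 : 0 ≤ lam) (h1 : lam ≤ 1) (f : W) (s : Q) :
    Admissible lam Δ (Potts.away E f) (Potts.pin lam h (nbrs E f) s) ∅ :=
  Admissible.pin (by simpa using H.away h1 f) h0 h1 (disjoint_empty_right _) s

/-- Greedy colouring, by induction on the number of edges: some spin at `f` has positive field, and
fixing it leaves an admissible model. This covers `lam = 0`. -/
theorem weightedSum_pos (H : Admissible lam Δ E h T) (h0 : 0 ≤ lam) (h1 : lam ≤ 1)
    (hq : (1 - lam) * Δ < Fintype.card Q) : 0 < weightedSum lam E h fun _ => 1 := by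
  induction hn : E.card using Nat.strong_induction_on generalizing E h T with
  | _ n ih =>
  subst hn
  rcases E.eq_empty_or_nonempty with rfl | ⟨e, he⟩
  · simp only [weightedSum, weight, prod_empty, mul_one]
    rw [← Fintype.prod_sum]
    exact prod_pos fun v _ => H.sum_pos h1 hq v
  · induction e using Sym2.ind with
    | _ f w =>
    have hlt : (Potts.away E f).card < E.card :=
      card_lt_card (filter_ssubset.2 ⟨_, he, by simp⟩)
    have hs : ∀ s, 0 < slice lam E h f s fun _ => 1 := by
      intro s
      have := ih _ hlt (H.pin_away h0 h1 f s) rfl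
      rw [weightedSum_away_eq lam H.1 h f s _ fun _ _ => rfl] at this
      exact pos_of_mul_pos_right this (H.sum_pos h1 hq f).le
    rw [weightedSum_eq_sum_slice lam H.1 h f _ fun _ _ => rfl]
    obtain ⟨i, hi, hpos⟩ := (sum_pos_iff_of_nonneg fun i _ => H.2 f i).1 (H.sum_pos h1 hq f)
    exact sum_pos' (fun s _ => mul_nonneg (H.2 f s) (hs s).le)
      ⟨i, mem_univ i, mul_pos hpos (hs i)⟩

theorem slice_pos (H : Admissible lam Δ E h T) (h0 : 0 ≤ lam) (h1 : lam ≤ 1)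
    (hq : (1 - lam) * Δ < Fintype.card Q) (f : W) (s : Q) : 0 < slice lam E h f s fun _ => 1 := by
  have := (H.pin_away h0 h1 f s).weightedSum_pos h0 h1 hq
  rw [weightedSum_away_eq lam H.1 h f s _ fun _ _ => rfl] at this
  exact pos_of_mul_pos_right this (H.sum_pos h1 hq f).le

end Admissible

/-! ### Contraction at a single vertex -/

/-- Weakening a single spin `c` of a measure `u` by the factor `lam` rather than a spin `c'` changes
the mean of `P` by at most `μ / (K - μ)` times the oscillation of `P`, where `μ = 1 - lam` and `1 / K`
bounds the probability of `c` under `u`. -/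
theorem abs_weakened_mean_sub_le {lam K D : ℝ} (h1 : lam ≤ 1) (hK : 1 - lam < K)
    (u P : Q → ℝ) (hu : ∀ s, 0 ≤ u s) (hpos : 0 < ∑ s, u s) (huK : ∀ s, K * u s ≤ ∑ t, u t)
    (hP : ∀ s t, |P s - P t| ≤ D) (c c' : Q) :
    |(∑ s, u s * (if s = c then lam else 1) * P s) / (∑ s, u s * if s = c then lam else 1) -
      (∑ s, u s * (if s = c' then lam else 1) * P s) / (∑ s, u s * if s = c' then lam else 1)| ≤
      (1 - lam) / (K - (1 - lam)) * D := by
  wlog hle : u c' ≤ u c generalizing c c'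
  · rw [abs_sub_comm]
    exact this c' c (le_of_not_ge hle)
  have hD : 0 ≤ D := by simpa using hP c c
  have hA : ∀ d, ∑ s, u s * (if s = d then lam else 1) = ∑ s, u s - (1 - lam) * u d := by
    intro d
    have : ∀ s, u s * (if s = d then lam else 1) =
        u s - if s = d then (1 - lam) * u s else 0 := by
      intro s; split_ifs <;> ring
    simp [this, sum_sub_distrib]
  have hA0 : ∀ d, (K - (1 - lam)) * u d ≤ ∑ s, u s - (1 - lam) * u d := by
    intro d; linarith [huK d]
  have hApos : ∀ d, 0 < ∑ s, u s - (1 - lam) * u d := by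
    intro d
    rcases (hu d).eq_or_lt with hd | hd
    · rw [← hd]; simpa using hpos
    · exact (mul_pos (sub_pos.2 hK) hd).trans_le (hA0 d)
  have hcoef : 0 ≤ (1 - lam) / (K - (1 - lam)) := div_nonneg (by linarith) (by linarith)
  rcases eq_or_ne c c' with rfl | hne
  · simpa using mul_nonneg hcoef hD
  rw [hA, hA]
  set A := ∑ s, u s - (1 - lam) * u c with hAdef
  set A' := ∑ s, u s - (1 - lam) * u c' with hAdef'
  have hAA' : A ≤ A' := by
    have := mul_le_mul_of_nonneg_left hle (sub_nonneg.2 h1)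
    linarith
  have hApos1 : 0 < A := hApos c
  have hApos2 : 0 < A' := hApos c'
  let r : Q → ℝ := fun s =>
    u s * (if s = c then lam else 1) / A - u s * (if s = c' then lam else 1) / A'
  have hr0 : ∑ s, r s = 0 := by
    simp only [r, sum_sub_distrib, ← sum_div, hA]
    rw [div_self hApos1.ne', div_self hApos2.ne', sub_self]
  have hr : ∀ s, s ≠ c → 0 ≤ r s := by
    intro s hs
    simp only [r, hs, if_false, mul_one]
    refine sub_nonneg.2 (div_le_div₀ (hu s) ?_ hApos1 hAA')
    exact mul_le_of_le_one_right (hu s) (by split_ifs <;> linarith)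
  have hrc : -r c ≤ (1 - lam) / (K - (1 - lam)) := by
    have e1 : -r c = u c / A' - u c * lam / A := by simp [r, hne]
    have e2 : u c / A' ≤ u c / A := div_le_div_of_nonneg_left (hu c) hApos1 hAA'
    have e3 : u c / A - u c * lam / A = (1 - lam) * (u c / A) := by ring
    have e4 : u c / A ≤ 1 / (K - (1 - lam)) := by
      rw [div_le_div_iff₀ hApos1 (sub_pos.2 hK)]
      linarith [hA0 c]
    have e5 := mul_le_mul_of_nonneg_left e4 (sub_nonneg.2 h1)
    rw [mul_one_div] at e5
    linarith
  -- As `r` has total mass zero, the constant `P c` may be subtracted; this removes the only term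
  -- where `r` may be negative.
  have hexp : (∑ s, u s * (if s = c then lam else 1) * P s) / A -
      (∑ s, u s * (if s = c' then lam else 1) * P s) / A' =
      ∑ s ∈ univ.erase c, r s * (P s - P c) := by
    rw [sum_erase _ (by simp)]
    simp only [mul_sub, sum_sub_distrib]
    rw [← sum_mul, hr0, zero_mul, sub_zero, sum_div, sum_div, ← sum_sub_distrib]
    exact sum_congr rfl fun s _ => by simp only [r]; ring
  have hsum : ∑ s ∈ univ.erase c, r s = -r c := by
    rw [← add_sum_erase _ _ (mem_univ c)] at hr0
    linarith
  rw [hexp]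
  calc |∑ s ∈ univ.erase c, r s * (P s - P c)|
      ≤ ∑ s ∈ univ.erase c, r s * D := by
        refine (abs_sum_le_sum_abs _ _).trans (sum_le_sum fun s hs => ?_)
        have := hr s (mem_erase.1 hs).1
        rw [abs_mul, abs_of_nonneg this]
        exact mul_le_mul_of_nonneg_left (hP s c) this
    _ = -r c * D := by rw [← sum_mul, hsum]
    _ ≤ _ := mul_le_mul_of_nonneg_right hrc hD

/-- The expectation of `φ`. -/
noncomputable def mean (lam : ℝ) (E : Finset (Sym2 W)) (h : W → Q → ℝ) (φ : (W → Q) → ℝ) : ℝ :=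
  weightedSum lam E h φ / weightedSum lam E h fun _ => 1

theorem one_sub_prod_le {ι : Type*} (s : Finset ι) (p : ι → Prop) [DecidablePred p] {lam : ℝ}
    (h0 : 0 ≤ lam) (h1 : lam ≤ 1) :
    1 - ∏ i ∈ s, (if p i then lam else 1) ≤ ∑ i ∈ s, if p i then 1 - lam else 0 := by
  classical
  induction s using Finset.induction_on with
  | empty => simp
  | insert a s ha ih =>
    rw [prod_insert ha, sum_insert ha]
    have hle : ∏ i ∈ s, (if p i then lam else 1) ≤ 1 :=
      prod_le_one (fun i _ => by split_ifs <;> linarith) (fun i _ => by split_ifs <;> linarith)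
    split_ifs with hp
    · nlinarith
    · linarith

theorem restWeight_nonneg {lam : ℝ} (h0 : 0 ≤ lam) (E : Finset (Sym2 W)) {h : W → Q → ℝ}
    (hh : ∀ v i, 0 ≤ h v i) (f : W) (σ : W → Q) : 0 ≤ restWeight lam E h f σ :=
  mul_nonneg (prod_nonneg fun _ _ => hh _ _) (prod_nonneg fun e _ => edgeWeight_nonneg h0 σ e)

theorem weight_nonneg {lam : ℝ} (h0 : 0 ≤ lam) (E : Finset (Sym2 W)) {h : W → Q → ℝ}
    (hh : ∀ v i, 0 ≤ h v i) (σ : W → Q) : 0 ≤ weight lam E h σ :=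
  mul_nonneg (prod_nonneg fun _ _ => hh _ _) (prod_nonneg fun e _ => edgeWeight_nonneg h0 σ e)

namespace Admissible

variable {lam : ℝ} {Δ : ℕ} {E : Finset (Sym2 W)} {h : W → Q → ℝ} {S T : Finset W}

theorem abs_mean_le (H : Admissible lam Δ E h T) (h0 : 0 ≤ lam) (h1 : lam ≤ 1)
    (hq : (1 - lam) * Δ < Fintype.card Q) {φ : (W → Q) → ℝ} (hφ : ∀ σ, |φ σ| ≤ 1) :
    |mean lam E h φ| ≤ 1 := by
  have hpos := H.weightedSum_pos h0 h1 hq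
  rw [mean, abs_div, abs_of_pos hpos, div_le_one hpos]
  refine (abs_sum_le_sum_abs _ _).trans (sum_le_sum fun σ _ => ?_)
  have := weight_nonneg h0 E H.2 σ
  rw [abs_mul, abs_of_nonneg this]
  exact mul_le_mul_of_nonneg_left (hφ σ) this

/-- A spin at `f` has probability at most `1 / (q - (1 - lam) (Δ - 1))`. -/
theorem mul_slice_le (H : Admissible lam Δ E h T) (h0 : 0 ≤ lam) (h1 : lam ≤ 1) {f : W}
    (hf : f ∈ T) (s : Q) :
    (Fintype.card Q - (1 - lam) * (Δ - 1)) * (h f s * slice lam E h f s fun _ => 1) ≤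
      ∑ t, h f t * slice lam E h f t fun _ => 1 := by
  let g : (W → Q) → Q → ℝ := fun σ t => h f t * ∏ w ∈ nbrs E f, if σ w = t then lam else 1
  have hg : ∀ t, h f t * slice lam E h f t (fun _ => 1) =
      (∑ σ, g σ t * restWeight lam E h f σ) / Fintype.card Q := by
    intro t
    simp only [slice, restWeight_pin_nbrs lam H.1, mul_one, g]
    rw [← mul_div_assoc, mul_sum]
    simp only [mul_assoc]
  have hprod0 : ∀ (σ : W → Q) t, 0 ≤ ∏ w ∈ nbrs E f, if σ w = t then lam else (1 : ℝ) := fun σ t =>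
    prod_nonneg fun i _ => by split_ifs <;> linarith
  have hprod1 : ∀ (σ : W → Q) t, ∏ w ∈ nbrs E f, (if σ w = t then lam else (1 : ℝ)) ≤ 1 := fun σ t =>
    prod_le_one (fun i _ => by split_ifs <;> linarith) (fun i _ => by split_ifs <;> linarith)
  have hg0 : ∀ σ t, 0 ≤ g σ t := fun σ t => mul_nonneg (H.2 f t) (hprod0 σ t)
  have hg1 : ∀ σ t, g σ t ≤ 1 := fun σ t => mul_le_one₀ (H.3 f t) (hprod0 σ t) (hprod1 σ t)
  -- With the other spins fixed, each neighbour removes at most `1 - lam` from the total weight at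
  -- `f`; since `f ∈ T` keeps a unit in reserve, at most `Δ - 1` units are in use.
  have hsum : ∀ σ, Fintype.card Q - (1 - lam) * (Δ - 1) ≤ ∑ t, g σ t := by
    intro σ
    have h4 := H.4 f
    simp only [hf, if_true] at h4
    have hle : ∑ t, (1 - g σ t) ≤ ∑ t, ((1 - h f t) +
        ∑ w ∈ nbrs E f, if σ w = t then 1 - lam else 0) := by
      refine sum_le_sum fun t _ => ?_
      have e1 := one_sub_prod_le (nbrs E f) (fun w => σ w = t) h0 h1
      have e2 := mul_le_of_le_one_left (sub_nonneg.2 (hprod1 σ t)) (H.3 f t)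
      simp only [g]
      linarith
    rw [sum_add_distrib, sum_comm] at hle
    simp only [sum_ite_eq, mem_univ, if_true, sum_const, nsmul_eq_mul] at hle
    rw [sum_sub_distrib, sum_const, card_univ, nsmul_eq_mul, mul_one] at hle
    linarith
  simp only [hg, ← sum_div]
  rw [← mul_div_assoc]
  refine div_le_div_of_nonneg_right ?_ (Nat.cast_nonneg _)
  rw [sum_comm, mul_sum]
  refine sum_le_sum fun σ _ => ?_
  rw [← sum_mul, ← mul_assoc]
  refine mul_le_mul_of_nonneg_right ?_ (restWeight_nonneg h0 E H.2 f σ)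
  have e0 : 0 ≤ ∑ t, g σ t := sum_nonneg fun t _ => hg0 σ t
  exact (mul_le_mul_of_nonneg_right (hsum σ) (hg0 σ s)).trans (mul_le_of_le_one_right e0 (hg1 σ s))

/-- If the mean of `φ` changes by at most `D` when the spin at `f` is changed, then it changes by at
most `(1 - lam) / (q - (1 - lam) Δ) * D` when the spin of an additional neighbour of `f` is. -/
theorem abs_mean_pin_sub_le {f : W} (H : Admissible lam Δ E h {f}) (h0 : 0 ≤ lam) (h1 : lam ≤ 1)
    (hq : (1 - lam) * Δ < Fintype.card Q) {φ : (W → Q) → ℝ}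
    (hφ : ∀ σ t, φ (Function.update σ f t) = φ σ) {D : ℝ}
    (hD : ∀ s t, |mean lam (Potts.away E f) (Potts.pin lam h (nbrs E f) s) φ -
      mean lam (Potts.away E f) (Potts.pin lam h (nbrs E f) t) φ| ≤ D) (c c' : Q) :
    |mean lam E (Potts.pin lam h {f} c) φ - mean lam E (Potts.pin lam h {f} c') φ| ≤
      (1 - lam) / (Fintype.card Q - (1 - lam) * Δ) * D := by
  have hs := H.slice_pos h0 h1 hq f
  have hsum := H.sum_pos h1 hq f
  have hP : ∀ s, mean lam (Potts.away E f) (Potts.pin lam h (nbrs E f) s) φ =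
      slice lam E h f s φ / slice lam E h f s fun _ => 1 := by
    intro s
    rw [mean, weightedSum_away_eq lam H.1 h f s φ hφ,
      weightedSum_away_eq lam H.1 h f s _ fun _ _ => rfl, mul_div_mul_left _ _ hsum.ne']
  simp only [hP] at hD
  -- The extra neighbour reweights the law of the spin at `f` but leaves the conditional means given
  -- that spin unchanged.
  have hc : ∀ d, mean lam E (Potts.pin lam h {f} d) φ =
      (∑ s, (h f s * slice lam E h f s fun _ => 1) * (if s = d then lam else 1) *
        (slice lam E h f s φ / slice lam E h f s fun _ => 1)) /
      ∑ s, (h f s * slice lam E h f s fun _ => 1) * if s = d then lam else 1 := by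
    intro d
    rw [mean, weightedSum_eq_sum_slice lam H.1 _ f φ hφ,
      weightedSum_eq_sum_slice lam H.1 _ f _ fun _ _ => rfl]
    congr 1
    · refine sum_congr rfl fun s _ => ?_
      rw [slice_pin_self]
      have := (hs s).ne'
      simp only [Potts.pin, mem_singleton, true_and]
      field_simp
    · refine sum_congr rfl fun s _ => ?_
      rw [slice_pin_self]
      simp only [Potts.pin, mem_singleton, true_and]
      ring
  have hK : (Fintype.card Q : ℝ) - (1 - lam) * Δ =
      Fintype.card Q - (1 - lam) * (Δ - 1) - (1 - lam) := by ring
  rw [hc, hc, hK]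
  refine abs_weakened_mean_sub_le h1 (by linarith) _ _ (fun s => mul_nonneg (H.2 f s) (hs s).le)
    ?_ (fun s => H.mul_slice_le h0 h1 (mem_singleton_self f) s) hD c c'
  obtain ⟨i, hi, hpos⟩ := (sum_pos_iff_of_nonneg fun i _ => H.2 f i).1 hsum
  exact sum_pos' (fun s _ => mul_nonneg (H.2 f s) (hs s).le)
    ⟨i, mem_univ i, mul_pos hpos (hs i)⟩

end Admissible

/-! ### Iteration: exponential decay of influence -/

theorem pin_comm (lam : ℝ) (h : W → Q → ℝ) (S T : Finset W) (s t : Q) :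
    pin lam (pin lam h T s) S t = pin lam (pin lam h S t) T s := by
  ext v i
  simp only [pin]
  ring

theorem pin_insert (lam : ℝ) (h : W → Q → ℝ) {f : W} {T : Finset W} (hf : f ∉ T) (s : Q) :
    pin lam (pin lam h T s) {f} s = pin lam h (insert f T) s := by
  ext v i
  by_cases hv : v = f
  · subst hv; simp [pin, hf]
  · simp [pin, hv]

namespace Admissible

variable {lam : ℝ} {Δ : ℕ} {T : Finset W}

/-- A change of the spin of one additional neighbour common to the vertices of `T` is a sequence of
changes of the spin of one additional neighbour of a single vertex. -/
theorem abs_mean_pin_sub_le_card {E : Finset (Sym2 W)} (h0 : 0 ≤ lam) (h1 : lam ≤ 1)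
    {φ : (W → Q) → ℝ} {D : ℝ}
    (hD : ∀ f ∈ T, ∀ h : W → Q → ℝ, Admissible lam Δ E h {f} → ∀ s t,
      |mean lam E (Potts.pin lam h {f} s) φ - mean lam E (Potts.pin lam h {f} t) φ| ≤ D)
    {h : W → Q → ℝ} (H : Admissible lam Δ E h T) (s t : Q) :
    |mean lam E (Potts.pin lam h T s) φ - mean lam E (Potts.pin lam h T t) φ| ≤ T.card * D := by
  induction T using Finset.induction_on generalizing h with
  | empty =>
    have : ∀ s, Potts.pin lam h ∅ s = h := by
      intro s; ext v i; simp [Potts.pin]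
    simp [this]
  | insert f T hf ih =>
    have hdis : Disjoint T {f} := by simpa using hf
    -- The intermediate field has spin `s` on `T` and `t` at `f`: first `f` changes, then `T`.
    have H1 : Admissible lam Δ E (Potts.pin lam h T s) {f} :=
      Admissible.pin (by rwa [union_comm, ← insert_eq]) h0 h1 hdis s
    have H2 : Admissible lam Δ E (Potts.pin lam h {f} t) T :=
      Admissible.pin (by rwa [← insert_eq]) h0 h1 hdis.symm t
    have e1 := hD f (mem_insert_self f T) _ H1 s t
    have e2 := ih (fun g hg => hD g (mem_insert_of_mem hg)) H2
    rw [pin_comm lam h {f} T s t, pin_insert lam h hf] at e1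
    rw [← pin_comm lam h {f} T s t, ← pin_comm lam h {f} T t t, pin_insert lam h hf t,
      pin_comm lam h {f} T s t] at e2
    refine (abs_sub_le _ _ _).trans ((add_le_add e1 e2).trans_eq ?_)
    rw [card_insert_of_notMem hf]
    push_cast
    ring

/-- The influence of an additional neighbour of `f` decays exponentially. -/
theorem abs_mean_pin_sub_le_pow (h0 : 0 ≤ lam) (h1 : lam ≤ 1)
    (hq : (1 - lam) * Δ < Fintype.card Q) {ρ : ℝ} (hρ0 : 0 ≤ ρ)
    (hρ : (1 - lam) * (Δ - 1) ≤ ρ * (Fintype.card Q - (1 - lam) * Δ))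
    {d : W → ℕ∞} {φ : (W → Q) → ℝ} (hφ1 : ∀ σ, |φ σ| ≤ 1)
    (hφ : ∀ v, d v ≠ 0 → ∀ σ t, φ (Function.update σ v t) = φ σ) (n : ℕ)
    {E : Finset (Sym2 W)} (hd : ∀ v w, s(v, w) ∈ E → d v ≤ d w + 1) {f : W} (hf : n ≤ d f)
    {h : W → Q → ℝ} (H : Admissible lam Δ E h {f}) (s t : Q) :
    |mean lam E (Potts.pin lam h {f} s) φ - mean lam E (Potts.pin lam h {f} t) φ| ≤
      2 * ρ ^ n := by
  induction n generalizing E f h s t with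
  | zero =>
    have key : ∀ s, |mean lam E (Potts.pin lam h {f} s) φ| ≤ 1 := fun s =>
      (Admissible.pin (T := ∅) (by simpa using H) h0 h1 (disjoint_empty_right _) s).abs_mean_le
        h0 h1 hq hφ1
    have e1 := abs_sub (mean lam E (Potts.pin lam h {f} s) φ) (mean lam E (Potts.pin lam h {f} t) φ)
    have e2 := key s
    have e3 := key t
    simp only [pow_zero]
    linarith
  | succ n ih =>
    have hf0 : d f ≠ 0 := by
      intro h
      rw [h] at hf
      simp at hf
    -- Only a Lipschitz bound on `d` is required, so it survives the deletion of edges.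
    have hd' : ∀ v w, s(v, w) ∈ Potts.away E f → d v ≤ d w + 1 := fun v w hvw =>
      hd v w (mem_filter.1 hvw).1
    have hw : ∀ w ∈ nbrs E f, (n : ℕ∞) ≤ d w := by
      intro w hw
      have := hf.trans (hd f w (mem_nbrs.1 hw))
      push_cast at this
      exact (ENat.add_le_add_iff_right ENat.one_ne_top).1 this
    have hD := fun s t => (H.away h1 f).abs_mean_pin_sub_le_card h0 h1
      (fun w hwN h' H' s t => ih hd' (hw w hwN) H' s t) s t
    refine (H.abs_mean_pin_sub_le h0 h1 hq (hφ f hf0) hD s t).trans ?_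
    have hK : 0 < (Fintype.card Q : ℝ) - (1 - lam) * Δ := by linarith
    -- The unit reserved at `f` is what improves `Δ` to `Δ - 1` neighbours.
    have hdeg : (1 - lam) * ((nbrs E f).card + 1) ≤ (1 - lam) * Δ := by
      have h4 := H.4 f
      have : 0 ≤ ∑ i, (1 - h f i) := sum_nonneg fun i _ => sub_nonneg.2 (H.3 f i)
      simp only [mem_singleton, if_true] at h4
      linarith
    have e : (1 - lam) * (nbrs E f).card / (Fintype.card Q - (1 - lam) * Δ) ≤ ρ := by
      rw [div_le_iff₀ hK]
      linarith
    calc (1 - lam) / (Fintype.card Q - (1 - lam) * Δ) * ((nbrs E f).card * (2 * ρ ^ n))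
        = (1 - lam) * (nbrs E f).card / (Fintype.card Q - (1 - lam) * Δ) * (2 * ρ ^ n) := by ring
      _ ≤ ρ * (2 * ρ ^ n) := mul_le_mul_of_nonneg_right e (by positivity)
      _ = _ := by ring

end Admissible

end FieldModel

-- From a region with boundary to a field model

universe u

open Classical in
/-- The edges of `G` with both endpoints in `R`. -/
noncomputable def innerEdges {V : Type u} (G : SimpleGraph V) (R : Finset V) : Finset (Sym2 R) :=
  univ.filter fun e => e.map Subtype.val ∈ G.edgeSet

open Classical in
/-- The neighbours of `v` outside `R`. -/
noncomputable def outerNbrs {V : Type u} (G : SimpleGraph V) [G.LocallyFinite] (R : Finset V)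
    (v : V) : Finset V :=
  (G.neighborFinset v).filter (· ∉ R)

open Classical in
/-- The spin of a vertex of the boundary, and no spin elsewhere. -/
noncomputable def outerSpin {V : Type u} {G : SimpleGraph V} {q : ℕ} {R : Finset V}
    (B : BoundaryConfig G q R) (v : V) : Option (Fin q) :=
  if h : v ∈ boundary G R then B ⟨v, h⟩ else none

/-- The external field that a boundary configuration exerts on the region. -/
noncomputable def boundaryField {V : Type u} (G : SimpleGraph V) [G.LocallyFinite] {q : ℕ}
    (lam : ℝ) {R : Finset V} (B : BoundaryConfig G q R) (v : R) (i : Fin q) : ℝ :=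
  ∏ w ∈ outerNbrs G R v, if outerSpin B w = some i then lam else 1

section Region

variable {V : Type u} {G : SimpleGraph V} {q : ℕ} {R : Finset V}

theorem spin_of_mem (B : BoundaryConfig G q R) (σ : Config q R) (v : R) :
    spin G B σ v = some (σ v) := by
  simp [spin]

theorem spin_of_notMem (B : BoundaryConfig G q R) (σ : Config q R) {v : V} (hv : v ∉ R) :
    spin G B σ v = outerSpin B v := by
  simp [spin, outerSpin, hv]

theorem mem_innerEdges {v w : R} : s(v, w) ∈ innerEdges G R ↔ G.Adj v w := by
  simp [innerEdges]

variable [G.LocallyFinite]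

theorem mem_outerNbrs {v w : V} : w ∈ outerNbrs G R v ↔ G.Adj v w ∧ w ∉ R := by
  simp [outerNbrs]

open Classical in
-- Edges inside `R` give the interaction. Every other edge of `E(R)` has exactly one endpoint in `R`
-- and gives one factor of the field there.
theorem pow_mon (lam : ℝ) (B : BoundaryConfig G q R) (σ : Config q R) :
    lam ^ mon G B σ = weight lam (innerEdges G R) (boundaryField G lam B) σ := by
  have h1 : lam ^ mon G B σ = ∏ e ∈ edgesMeeting G R,
      if ∃ c : Fin q, ∀ v ∈ e, spin G B σ v = some c then lam else 1 := by
    rw [prod_ite, prod_const_one, mul_one, prod_const]; rfl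
  rw [h1, ← prod_filter_mul_prod_filter_not _ (fun e => ∀ v ∈ e, v ∈ R), weight, mul_comm]
  congr 1
  · have : (edgesMeeting G R).filter (fun e => ¬ ∀ v ∈ e, v ∈ R) =
        (univ.sigma fun v : R => outerNbrs G R v).image fun x => s((x.1 : V), x.2) := by
      ext e
      simp only [edgesMeeting, mem_filter, mem_biUnion, mem_image, mem_sigma, mem_univ, true_and,
        SimpleGraph.mem_incidenceFinset, Sigma.exists, mem_outerNbrs]
      constructor
      · rintro ⟨⟨v, hv, he, hve⟩, hne⟩
        obtain ⟨w, rfl⟩ := Sym2.mem_iff_exists.1 hve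
        refine ⟨⟨v, hv⟩, w, ⟨by simpa using he, fun hw => hne ?_⟩, rfl⟩
        simp [hv, hw]
      · rintro ⟨v, w, ⟨hadj, hw⟩, rfl⟩
        refine ⟨⟨v, v.2, ⟨by simpa using hadj, by simp⟩⟩, fun h => hw (h w (by simp))⟩
    rw [this, prod_image, prod_sigma]
    · refine prod_congr rfl fun v _ => prod_congr rfl fun w hw => ?_
      simp only [Sym2.mem_iff, forall_eq_or_imp, forall_eq, spin_of_mem,
        spin_of_notMem B σ (mem_outerNbrs.1 hw).2, Option.some.injEq, exists_eq_left']
    · rintro ⟨v, w⟩ hx ⟨v', w'⟩ hx' h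
      simp only [coe_sigma, Set.mem_sigma_iff, mem_coe, mem_outerNbrs] at hx hx'
      rcases Sym2.eq_iff.1 h with ⟨h1, h2⟩ | ⟨h1, h2⟩
      · have := Subtype.ext h1
        simp only at h2
        subst h2 this
        rfl
      · exact absurd (show w' ∈ R from (show (v : V) = w' from h1) ▸ v.2) hx'.2.2
  · have : (edgesMeeting G R).filter (fun e => ∀ v ∈ e, v ∈ R) =
        (innerEdges G R).image (Sym2.map Subtype.val) := by
      ext e
      simp only [edgesMeeting, mem_filter, mem_biUnion, mem_image,
        SimpleGraph.mem_incidenceFinset]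
      constructor
      · rintro ⟨⟨v, hv, he, hve⟩, hall⟩
        obtain ⟨w, rfl⟩ := Sym2.mem_iff_exists.1 hve
        exact ⟨s(⟨v, hv⟩, ⟨w, hall w (by simp)⟩), mem_innerEdges.2 (by simpa using he), by simp⟩
      · rintro ⟨e, he, rfl⟩
        induction e using Sym2.ind with
        | _ v w =>
        have := mem_innerEdges.1 he
        exact ⟨⟨v, v.2, by simpa using this, by simp⟩, by simp⟩
    rw [this, prod_image (fun a _ b _ h => Sym2.map.injective Subtype.val_injective h)]
    refine prod_congr rfl fun e _ => ?_
    induction e using Sym2.ind with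
    | _ v w =>
    simp only [edgeWeight_mk, Sym2.map_mk, Sym2.mem_iff, forall_eq_or_imp, forall_eq, spin_of_mem,
      Option.some.injEq, exists_eq_left', eq_comm (a := σ w)]

open Classical in
theorem boundaryField_eq_pin (lam : ℝ) (B : BoundaryConfig G q R) (y : boundary G R) (c : Fin q)
    (hc : B y = some c) :
    boundaryField G lam B =
      pin lam (boundaryField G lam (Function.update B y none)) (univ.filter fun v : R => G.Adj v y)
        c := by
  ext v i
  have hupd : ∀ w, w ≠ (y : V) → outerSpin (Function.update B y none) w = outerSpin B w := by
    intro w hw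
    unfold outerSpin
    split_ifs with h
    · rw [Function.update_of_ne]
      rintro rfl
      exact hw rfl
    · rfl
  have hy : outerSpin B y = some c := by simp [outerSpin, hc]
  have hy' : outerSpin (Function.update B y none) y = none := by simp [outerSpin]
  simp only [pin, mem_filter, mem_univ, true_and, boundaryField]
  by_cases hadj : G.Adj v y
  · have hmem : (y : V) ∈ outerNbrs G R v := mem_outerNbrs.2 ⟨hadj, y.2.1⟩
    rw [← mul_prod_erase _ _ hmem, ← mul_prod_erase (outerNbrs G R v) _ hmem, hy, hy', mul_comm]
    simp only [reduceCtorEq, if_false, one_mul, hadj, true_and, Option.some.injEq, eq_comm (a := c)]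
    congr 1
    exact prod_congr rfl fun w hw => by rw [hupd w (mem_erase.1 hw).1]
  · simp only [hadj, false_and, if_false, mul_one]
    refine prod_congr rfl fun w hw => ?_
    rw [hupd w]
    rintro rfl
    exact hadj (mem_outerNbrs.1 hw).1

open Classical in
-- A free `y` adds nothing to the field but still counts in the degree, so each of its neighbours
-- has a unit to spare.
theorem admissible_boundaryField {Δ : ℕ} (hΔ : ∀ v, G.degree v ≤ Δ) {lam : ℝ} (h0 : 0 ≤ lam)
    (h1 : lam ≤ 1) (B : BoundaryConfig G q R) (y : boundary G R) (hy : B y = none) :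
    Admissible lam Δ (innerEdges G R) (boundaryField G lam B)
      (univ.filter fun v : R => G.Adj v y) := by
  refine ⟨fun e he => ?_, fun v i => ?_, fun v i => ?_, fun v => ?_⟩
  · induction e using Sym2.ind with
    | _ v w =>
    rw [Sym2.mk_isDiag_iff]
    rintro rfl
    exact G.loopless.irrefl _ (mem_innerEdges.1 he)
  · exact prod_nonneg fun w _ => by split_ifs <;> linarith
  · exact prod_le_one (fun w _ => by split_ifs <;> linarith) fun w _ => by split_ifs <;> linarith
  · have e1 : ∑ i, (1 - boundaryField G lam B v i) ≤
        ∑ w ∈ outerNbrs G R v, if w = y then 0 else 1 - lam := by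
      refine (sum_le_sum fun i _ =>
        one_sub_prod_le _ (fun w => outerSpin B w = some i) h0 h1).trans ?_
      rw [sum_comm]
      refine sum_le_sum fun w _ => ?_
      split_ifs with hw
      · subst hw
        simp [outerSpin, hy]
      · cases h : outerSpin B w with
        | none => simpa using h1
        | some c => simp
    have e2 : (nbrs (innerEdges G R) v).card + (outerNbrs G R v).card = G.degree v := by
      rw [← SimpleGraph.card_neighborFinset_eq_degree,
        ← card_filter_add_card_filter_not (s := G.neighborFinset v) (· ∈ R)]
      congr 1
      rw [← card_map (Function.Embedding.subtype _)]
      congr 1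
      ext w
      simp [mem_nbrs, mem_innerEdges, and_comm]
    have e3 : ((outerNbrs G R v).filter fun w => ¬ w = (y : V)).card +
        (if v ∈ univ.filter (fun v : R => G.Adj v y) then 1 else 0) ≤ (outerNbrs G R v).card := by
      have h2 : (outerNbrs G R v).filter (fun w => ¬ w = (y : V)) = (outerNbrs G R v).erase y := by
        ext w; simp [and_comm]
      rw [h2]
      split_ifs with h3
      · have h4 : (y : V) ∈ outerNbrs G R v := mem_outerNbrs.2 ⟨by simpa using h3, y.2.1⟩
        exact (card_erase_add_one h4).le
      · exact card_le_card (erase_subset _ _)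
    rw [sum_ite, sum_const_zero, zero_add, sum_const, nsmul_eq_mul] at e1
    have e4 : (((outerNbrs G R v).filter fun w => ¬ w = (y : V)).card : ℝ) +
        ((nbrs (innerEdges G R) v).card +
          if v ∈ univ.filter (fun v : R => G.Adj v y) then 1 else 0) ≤ Δ := by
      have := hΔ v
      have h5 : ((outerNbrs G R v).filter fun w => ¬ w = (y : V)).card +
        ((nbrs (innerEdges G R) v).card +
          if v ∈ univ.filter (fun v : R => G.Adj v y) then 1 else 0) ≤ Δ := by omega
      exact_mod_cast h5
    have := mul_le_mul_of_nonneg_left e4 (sub_nonneg.2 h1)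
    linarith

open Classical in
theorem partitionFunction_eq (lam : ℝ) (B : BoundaryConfig G q R) :
    partitionFunction G lam B =
      weightedSum lam (innerEdges G R) (boundaryField G lam B) fun _ => 1 := by
  simp only [partitionFunction, weightedSum, pow_mon, mul_one]

open Classical in
theorem sum_marginal_mul (lam : ℝ) (B : BoundaryConfig G q R) {Λ : Finset V} (hΛ : Λ ⊆ R)
    (g : Config q Λ → ℝ) :
    ∑ τ, marginal G lam B hΛ τ * g τ = mean lam (innerEdges G R) (boundaryField G lam B)
      fun σ => g (Finset.restrict₂ (π := fun _ => Fin q) hΛ σ) := by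
  simp only [marginal, sum_filter, sum_mul, ite_mul, zero_mul]
  rw [sum_comm, mean, weightedSum, sum_div, ← partitionFunction_eq]
  refine sum_congr rfl fun σ _ => ?_
  simp only [sum_ite_eq, mem_univ, if_true, gibbs, pow_mon]
  ring

/-! ### Total variation distance and graph distance -/

theorem two_mul_tvDist {α : Type*} [Fintype α] (p p' : α → ℝ) :
    2 * tvDist p p' = ∑ a, p a * (if p' a ≤ p a then 1 else -1) -
      ∑ a, p' a * (if p' a ≤ p a then 1 else -1) := by
  rw [tvDist, ← sum_sub_distrib, ← mul_assoc, mul_one_div_cancel two_ne_zero, one_mul]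
  refine sum_congr rfl fun a _ => ?_
  split_ifs with h
  · rw [abs_of_nonneg (by linarith)]; ring
  · rw [abs_of_nonpos (by linarith)]; ring

/-- The distance to `Λ` along the graph `H`. -/
noncomputable def edistTo (H : SimpleGraph V) (Λ : Finset V) (x : V) : ℕ∞ :=
  ⨅ v ∈ Λ, H.edist x v

theorem edistTo_le_add_one {H : SimpleGraph V} (Λ : Finset V) {x x' : V} (h : H.Adj x x') :
    edistTo H Λ x ≤ edistTo H Λ x' + 1 := by
  simp only [edistTo, ENat.iInf_add]
  refine le_iInf₂ fun v hv => iInf₂_le_of_le v hv ?_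
  rw [add_comm]
  refine SimpleGraph.edist_triangle.trans (add_le_add_left ?_ _)
  exact (SimpleGraph.edist_eq_one_iff_adj.2 h).le

open Classical in
-- The sign of the difference of the marginals is an observable bounded by `1`, so the decay of
-- means applies. Quantifying over `n` also covers infinite distance; the step from `y` into `R`
-- gains no factor, whence `n - 1`.
theorem tvDist_marginal_le {Δ : ℕ} (hΔ : ∀ v, G.degree v ≤ Δ) {lam : ℝ} (h0 : 0 ≤ lam)
    (h1 : lam ≤ 1) (hq : (1 - lam) * Δ < q) {ρ : ℝ} (hρ0 : 0 ≤ ρ)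
    (hρ : (1 - lam) * (Δ - 1) ≤ ρ * (q - (1 - lam) * Δ)) {Λ : Finset V} (hΛ : Λ ⊆ R)
    (y : boundary G R) {B B' : BoundaryConfig G q R} (hBB' : ∀ v, v ≠ y → B v = B' v)
    (hB : B y ≠ none) (hB' : B' y ≠ none) :
    0 < partitionFunction G lam B ∧ 0 < partitionFunction G lam B' ∧
      ∀ n : ℕ, (n : ℕ∞) ≤ distWithin G R y Λ →
        tvDist (marginal G lam B hΛ) (marginal G lam B' hΛ) ≤ Δ * ρ ^ (n - 1) := by
  obtain ⟨c, hc⟩ := Option.ne_none_iff_exists'.1 hB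
  obtain ⟨c', hc'⟩ := Option.ne_none_iff_exists'.1 hB'
  have hupd : Function.update B' y none = Function.update B y none := by
    ext1 v
    by_cases hv : v = y
    · subst hv; simp
    · simp [hv, hBB' v hv]
  set h := boundaryField G lam (Function.update B y none) with hh
  set T : Finset R := univ.filter fun v : R => G.Adj v y with hT
  have hq' : (1 - lam) * Δ < Fintype.card (Fin q) := by simpa using hq
  have hF : boundaryField G lam B = pin lam h T c := boundaryField_eq_pin lam B y c hc
  have hF' : boundaryField G lam B' = pin lam h T c' := by
    rw [boundaryField_eq_pin lam B' y c' hc', hupd]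
  have HT : Admissible lam Δ (innerEdges G R) h T :=
    admissible_boundaryField hΔ h0 h1 _ y (by simp)
  have Hpin : ∀ s, Admissible lam Δ (innerEdges G R) (pin lam h T s) ∅ := fun s =>
    Admissible.pin (by simpa using HT) h0 h1 (disjoint_empty_right _) s
  refine ⟨?_, ?_, fun n hn => ?_⟩
  · rw [partitionFunction_eq, hF]
    exact (Hpin c).weightedSum_pos h0 h1 hq'
  · rw [partitionFunction_eq, hF']
    exact (Hpin c').weightedSum_pos h0 h1 hq'
  let H := (G.induce (insert (y : V) (R : Set V))).spanningCoe
  have hadj : ∀ {v w : V}, v ∈ insert (y : V) (R : Set V) → w ∈ insert (y : V) (R : Set V) →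
      G.Adj v w → H.Adj v w := by
    intro v w hv hw hvw
    simp only [H, SimpleGraph.map_adj]
    exact ⟨⟨v, hv⟩, ⟨w, hw⟩, hvw, rfl, rfl⟩
  have hd : ∀ v w : R, s(v, w) ∈ innerEdges G R →
      edistTo H Λ v ≤ edistTo H Λ w + 1 := fun v w hvw =>
    edistTo_le_add_one Λ (hadj (Or.inr v.2) (Or.inr w.2) (mem_innerEdges.1 hvw))
  have hdT : ∀ v ∈ T, ((n - 1 : ℕ) : ℕ∞) ≤ edistTo H Λ v := by
    intro v hv
    have h2 : (n : ℕ∞) ≤ edistTo H Λ v + 1 := hn.trans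
      (edistTo_le_add_one Λ (hadj (Or.inl rfl) (Or.inr v.2) (by simpa using (mem_filter.1 hv).2.symm)))
    push_cast
    exact tsub_le_iff_right.2 h2
  let g : Config q Λ → ℝ := fun τ =>
    if marginal G lam B' hΛ τ ≤ marginal G lam B hΛ τ then 1 else -1
  have hg : ∀ τ, |g τ| ≤ 1 := fun τ => by simp only [g]; split_ifs <;> simp
  have hmain := HT.abs_mean_pin_sub_le_card h0 h1 (D := 2 * ρ ^ (n - 1))
    (φ := fun σ => g (Finset.restrict₂ (π := fun _ => Fin q) hΛ σ))
    (fun f hf h' H' s t => Admissible.abs_mean_pin_sub_le_pow h0 h1 hq' hρ0 (by simpa using hρ)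
      (d := fun v : R => edistTo H Λ v) (fun σ => hg _) ?_ (n - 1) hd (hdT f hf) H' s t) c c'
  · have htv := two_mul_tvDist (marginal G lam B hΛ) (marginal G lam B' hΛ)
    rw [sum_marginal_mul lam B hΛ g, sum_marginal_mul lam B' hΛ g, hF, hF'] at htv
    have hcard : (T.card : ℝ) ≤ Δ := by
      have : T.card ≤ G.degree y := by
        rw [← card_map (Function.Embedding.subtype _), ← SimpleGraph.card_neighborFinset_eq_degree]
        refine card_le_card fun v hv => ?_
        obtain ⟨w, hw, rfl⟩ := mem_map.1 hv
        simpa using (mem_filter.1 hw).2.symm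
      exact_mod_cast this.trans (hΔ y)
    have := mul_le_mul_of_nonneg_right hcard (by positivity : 0 ≤ 2 * ρ ^ (n - 1))
    have := le_abs_self (2 * tvDist (marginal G lam B hΛ) (marginal G lam B' hΛ))
    rw [htv] at this
    linarith
  · intro v hv σ t
    congr 1
    ext w : 1
    simp only [Finset.restrict₂]
    refine Function.update_of_ne ?_ _ _
    rintro rfl
    refine hv (le_antisymm ?_ zero_le)
    exact iInf₂_le_of_le (w : V) w.2 (by simp)

end Region

end Potts

theorem mainTheorem3 {V : Type*} (G : SimpleGraph V) [G.LocallyFinite] (Δ : ℕ)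
    (hΔ : ∀ v, G.degree v ≤ Δ) (q : ℕ) (lam : ℝ) (hlam0 : 0 ≤ lam) (hlam1 : lam ≤ 1)
    (hq : (1 - lam) * (2 * (Δ : ℝ) - 1) < (q : ℝ)) :
    Potts.StrongSpatialMixing G q lam := by
  -- Without edges the boundary is empty. For `Δ ≥ 1`, `Δ ≤ 2 Δ - 1` gives the weaker bound `hq'`.
  rcases Nat.eq_zero_or_pos Δ with rfl | hpos
  · refine ⟨1, 1, one_pos, one_pos, fun R _ Λ _ y => ?_⟩
    obtain ⟨-, u, -, hadj⟩ := y.2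
    have := (G.degree_pos_iff_exists_adj u).2 ⟨_, hadj⟩
    exact absurd (hΔ u) (by omega)
  have hΔ1 : (1 : ℝ) ≤ Δ := by exact_mod_cast hpos
  have hμ : 0 ≤ 1 - lam := sub_nonneg.2 hlam1
  have hq' : (1 - lam) * Δ < q := by nlinarith
  have hK : 0 < (q : ℝ) - (1 - lam) * Δ := by linarith
  -- The maximum with `1 / 2` keeps `ρ` positive, so that `Real.log ρ` serves as a decay rate.
  let ρ : ℝ := max (1 / 2) ((1 - lam) * (Δ - 1) / (q - (1 - lam) * Δ))
  have hρ0 : 0 < ρ := lt_max_of_lt_left (by norm_num)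
  have hρ1 : ρ < 1 := max_lt (by norm_num) ((div_lt_one hK).2 (by linarith))
  have hρ : (1 - lam) * (Δ - 1) ≤ ρ * (q - (1 - lam) * Δ) :=
    (div_le_iff₀ hK).1 (le_max_right _ _)
  -- The factor `1 / ρ` pays for the exponent `n - 1` in place of `n`.
  refine ⟨Δ / ρ, -Real.log ρ, by positivity, neg_pos.2 (Real.log_neg hρ0 hρ1),
    fun R _ Λ hΛ y B B' hBB' _ hB hB' => ?_⟩
  obtain ⟨hZ, hZ', hle⟩ := Potts.tvDist_marginal_le hΔ hlam0 hlam1 hq' hρ0.le hρ hΛ y hBB' hB hB'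
  refine ⟨hZ, hZ', ?_⟩
  unfold Potts.expDecay
  split_ifs with htop
  · rw [mul_zero]
    -- At infinite distance the bound holds for every `n`; its limit is `0`.
    refine ge_of_tendsto' (x := Filter.atTop) (f := fun n : ℕ => (Δ : ℝ) * ρ ^ n) ?_ fun n => ?_
    · simpa using (tendsto_pow_atTop_nhds_zero_of_lt_one hρ0.le hρ1).const_mul (Δ : ℝ)
    · exact hle (n + 1) (by rw [htop]; exact le_top)
  · set n := (Potts.distWithin G R y Λ).toNat with hn
    have hcard : (1 : ℝ) ≤ Λ.card := by
      have : Λ.Nonempty := by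
        rw [Finset.nonempty_iff_ne_empty]
        rintro rfl
        exact htop (by simp [Potts.distWithin])
      exact_mod_cast this.card_pos
    have hexp : Real.exp (- -Real.log ρ * n) = ρ ^ n := by
      rw [neg_neg, mul_comm, Real.exp_nat_mul, Real.exp_log hρ0]
    have hpow : ρ ^ (n - 1) ≤ ρ ^ n / ρ := by
      rw [le_div_iff₀ hρ0, ← pow_succ]
      exact pow_le_pow_of_le_one hρ0.le hρ1.le (by omega)
    rw [hexp]
    calc _ ≤ Δ * ρ ^ (n - 1) := hle n (ENat.natCast_toNat_le_self _)
      _ ≤ Δ * (ρ ^ n / ρ) := mul_le_mul_of_nonneg_left hpow (by positivity)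
      _ = 1 * (Δ / ρ * ρ ^ n) := by ring
      _ ≤ Λ.card * (Δ / ρ * ρ ^ n) := mul_le_mul_of_nonneg_right hcard (by positivity)
      _ = _ := by ring
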